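/- **Definitions.** A *universe of separations* is a lattice $(\vec U,\le,\vee,\wedge)$ with an order-reversing involution $\vec s\mapsto\vec s^{\,*}=\overleftarrow{s}$. An *order function* is a function $|\cdot|:\vec U\to[0,\infty)$ with $|\overleftarrow{s}|=|\vec s|$ and $|\vec r\vee\vec s|+|\vec r\wedge\vec s|\le|\vec r|+|\vec s|$. For $k\in\mathbb R$ let $\vec S_k=\{\vec u\in\vec U:|\vec u|<k\}$. A separation $\vec r$ is *degenerate* if $\vec r=\overleftarrow{r}$, *co-small* if $\overleftarrow{r}\le\vec r$, and *trivial* (in $\vec S_k$) if $\vec r<\vec s$ and $\vec r<\overleftarrow{s}$ for some $\vec s\in\vec S_k$. A *star* is a set of non-degenerate separations with $\vec r\le\overleftarrow{s}$ for all distinct members $\vec r,\vec s$. An *orientation* of $S_k$ is a set $O\subseteq\vec S_k$ containing exactly one element of $\{\vec s,\overleftarrow{s}\}$ for each $\vec s\in\vec S_k$; it is *consistent* if it never contains both $\overleftarrow{r}$ and $\vec s$ when $\vec r<\vec s$ and $\{\vec r,\overleftarrow{r}\}\ne\{\vec s,\overleftarrow{s}\}$. For $\mathcal F\subseteq 2^{\vec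 S_k}$, an *$\mathcal F$-tangle* of $S_k$ is a consistent orientation of $S_k$ with no subset in $\mathcal F$. An *$S_k$-profile* is a $\mathcal P$-tangle of $S_k$ for $\mathcal P=\{\{\vec r,\vec s,\overleftarrow{r}\wedge\overleftarrow{s}\}\subseteq\vec S_k\}$. If $\phi$ is a set of $S_k$-profiles, then $s=\{\vec s,\overleftarrow{s}\}$ with $\vec s\in\vec S_k$ is *$\phi$-essential* if there are distinct $P,Q\in\phi$ such that one orientation of $s$ lies in $P$ and its inverse in $Q$, and no separation of smaller order in $S_k$ has this property for $P,Q$. A set $\mathcal F\subseteq2^{\vec S_k}$ of stars is *standard* if $\{\overleftarrow{r}\}\in\mathcal F$ for every trivial $\vec r\in\vec S_k$. For $\vec r,\vec s\in\vec S_k$ with $\vec r$ neither trivial nor degenerate, $\vec s$ *emulates* $\vec r$ if $\vec r\le\vec s$ and $\vec s\vee\vec t\in\vec S_k$ for all $\vec t\in\vec S_k\setminus\{\overleftarrow{r}\}$ with $\vec t\ge\vec r$. $\mathcal F$ is *closed under shifting* if, whenever $\vec s$ emulates such an $\vec r$, then for every $\tau\in\mathcal F$ with $\overleftarrow{r}\notin\tau$,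 such that every element of $\tau$ or its inverse is $\ge\vec r$ and some element of $\tau$ is $\ge\vec r$, the image of $\tau$ under the map $f$ lies in $\mathcal F$, where $f(\vec x)=\vec x\vee\vec s$ if $\vec x\ge\vec r$, and $f(\vec x)=(\overleftarrow{x}\vee\vec s)^*$ otherwise. An *$S_k$-tree over $\mathcal F$* is a finite tree $T$ with at least one edge together with a map $\alpha$ from the set of oriented edges of $T$ to $\vec S_k$ such that $\alpha(y,x)=\alpha(x,y)^*$ for every oriented edge $(x,y)$, and $\{\alpha(t',t): t'\text{ a neighbour of }t\}\in\mathcal F$ for every vertex $t$. Its *leaf separations* are the $\alpha(w,u)$ with $w$ a leaf and $u$ its neighbour. **Lemma.** Let $\vec U$ be a universe of separations with an order function, and let $k$ be such that $\vec S_k$ is finite. Let $\phi$ be a set of $S_k$-profiles, and let $\mathcal F\subseteq2^{\vec S_k}$ be a standard set of stars that is closed under shifting and contains $\{\vec r\}$ for every non-degenerate co-small $\vec r\in\vec S_k$, such that $\phi$ is the set of $\mathcal F$-tangles of $S_k$. Let $\sigma=\{\vec s_i: i\in[n]\}\subseteq\vec S_k$ be a non-empty star such that each $s_i$ is $\phi$-essential,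 and let $\mathcal F'=\mathcal F\cup\{\{\overleftarrow{s_i}\}: i\in[n]\}$. Then either there is an $\mathcal F'$-tangle of $S_k$, or there is an $S_k$-tree over $\mathcal F'$ in which each $\vec s_i$ is a leaf separation. -/

import Mathlib

/-- A universe of (oriented) separations: a lattice with an order-reversing involution `rev`. -/
class SepUniverse (U : Type*) extends Lattice U where
  rev : U → U
  rev_rev : ∀ r, rev (rev r) = r
  rev_le_rev : ∀ {r s}, r ≤ s → rev s ≤ rev r

namespace SepUniverse

section Basic

variable {U : Type*} [SepUniverse U]

/-- Order functions: real, non-negative, symmetric and submodular. -/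
structure IsOrderFunction (ord : U → ℝ) : Prop where
  nonneg : ∀ r, 0 ≤ ord r
  symm : ∀ r, ord (rev r) = ord r
  submodular : ∀ r s, ord (r ⊔ s) + ord (r ⊓ s) ≤ ord r + ord s

/-- The separation system of all oriented separations of order less than `k`. -/
def sepsBelow (ord : U → ℝ) (k : ℝ) : Set U := {u | ord u < k}

/-- `r` is degenerate if it equals its inverse. -/
def Degenerate (r : U) : Prop := r = rev r

/-- `r` is small if `r ≤ r*`. -/
def Small (r : U) : Prop := r ≤ rev r

/-- `r` is co-small if its inverse is small. -/
def CoSmall (r : U) : Prop := Small (rev r)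

/-- `r` is trivial in the separation system `S`. -/
def TrivialIn (S : Set U) (r : U) : Prop := ∃ s ∈ S, r < s ∧ r < rev s

/-- A star: a set of non-degenerate separations such that `r ≤ s*` for all distinct members. -/
def IsStar (σ : Set U) : Prop :=
  (∀ r ∈ σ, ¬ Degenerate r) ∧ ∀ r ∈ σ, ∀ s ∈ σ, r ≠ s → r ≤ rev s

/-- `F` is a set of stars in the separation system `S`. -/
def IsSetOfStars (S : Set U) (F : Set (Set U)) : Prop := ∀ σ ∈ F, σ ⊆ S ∧ IsStar σ

/-- `O` contains exactly one orientation of every separation in `S`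
(for a degenerate separation its two orientations coincide). -/
def IsOrientation (S O : Set U) : Prop :=
  O ⊆ S ∧ ∀ s ∈ S, (s ∈ O ∨ rev s ∈ O) ∧ (s ∈ O → rev s ∈ O → Degenerate s)

/-- Consistency: if `r < s` are orientations of distinct separations,
then `O` does not contain both `r*` and `s`. -/
def Consistent (O : Set U) : Prop :=
  ∀ r s, r < s → r ≠ rev s → ¬ (rev r ∈ O ∧ s ∈ O)

/-- An `F`-tangle of `S`: a consistent orientation of `S` with no subset in `F`. -/
def IsTangle (S : Set U) (F : Set (Set U)) (O : Set U) : Prop :=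
  IsOrientation S O ∧ Consistent O ∧ ∀ σ ∈ F, ¬ σ ⊆ O

/-- The sets `{r, s, r* ∧ s*}` contained in `S`. -/
def profileTriples (S : Set U) : Set (Set U) :=
  {σ | (∃ r s, σ = {r, s, rev r ⊓ rev s}) ∧ σ ⊆ S}

/-- An `S`-profile. -/
def IsProfile (S P : Set U) : Prop := IsTangle S (profileTriples S) P

/-- The (unoriented) separation of `s` distinguishes `P` and `Q`. -/
def Distinguishes (s : U) (P Q : Set U) : Prop :=
  (s ∈ P ∧ rev s ∈ Q) ∨ (rev s ∈ P ∧ s ∈ Q)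

/-- `s` distinguishes `P` and `Q`, and its order is least possible among the separations
that do so. -/
def DistinguishesEfficiently (ord : U → ℝ) (S : Set U) (s : U) (P Q : Set U) : Prop :=
  s ∈ S ∧ Distinguishes s P Q ∧ ∀ t ∈ S, Distinguishes t P Q → ord s ≤ ord t

/-- `s` is `φ`-essential. -/
def Essential (ord : U → ℝ) (S : Set U) (φ : Set (Set U)) (s : U) : Prop :=
  ∃ P ∈ φ, ∃ Q ∈ φ, P ≠ Q ∧ DistinguishesEfficiently ord S s P Q

/-- `F` forces `r`. -/
def Forces (F : Set (Set U)) (r : U) : Prop := {rev r} ∈ F ∨ Degenerate r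

/-- `F` is standard for `S`: it forces every separation that is trivial in `S`. -/
def IsStandard (S : Set U) (F : Set (Set U)) : Prop := ∀ r ∈ S, TrivialIn S r → Forces F r

/-- All orientations of separations in `S` that have an orientation `≥ r`. -/
def above (S : Set U) (r : U) : Set U := {x | x ∈ S ∧ (r ≤ x ∨ r ≤ rev x)}

open Classical in
/-- The shifting map from `r` to `s`. It is used only on elements of `above S r` other than `r*`,
where `r` is neither trivial in `S` nor degenerate; on these it sends `x ≥ r` to `x ∨ s`,
and the inverse of such an `x` to `(x ∨ s)*`. -/
noncomputable def shift (r s x : U) : U := if r ≤ x then x ⊔ s else rev (rev x ⊔ s)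

/-- `s` emulates `r` in `S`. -/
def Emulates (S : Set U) (s r : U) : Prop :=
  r ≤ s ∧ ∀ t ∈ S, r ≤ t → t ≠ rev r → s ⊔ t ∈ S

/-- `s` emulates `r` in `S` for `F`. -/
def EmulatesFor (S : Set U) (F : Set (Set U)) (s r : U) : Prop :=
  Emulates S s r ∧
    ∀ σ ∈ F, IsStar σ → σ ⊆ above S r \ {rev r} → (∃ t ∈ σ, r ≤ t) → shift r s '' σ ∈ F

/-- `F` is closed under shifting in `S`. -/
def ClosedUnderShifting (S : Set U) (F : Set (Set U)) : Prop :=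
  ∀ r ∈ S, ∀ s ∈ S, ¬ TrivialIn S r → ¬ Degenerate r → Emulates S s r → EmulatesFor S F s r

/-- An `S`-tree over `F`: a finite tree with at least one edge, with its oriented edges (darts)
labelled by elements of `S`, compatibly with inversion, such that the labels of the edges
pointing to any given vertex form a set in `F`. -/
structure STree (S : Set U) (F : Set (Set U)) where
  V : Type
  finite_V : Finite V
  T : SimpleGraph V
  isTree : T.IsTree
  exists_edge : ∃ x y, T.Adj x y
  α : T.Dart → U
  α_mem : ∀ e, α e ∈ S
  α_symm : ∀ e, α e.symm = rev (α e)
  star_mem : ∀ t : V, {x | ∃ e : T.Dart, e.snd = t ∧ α e = x} ∈ F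

/-- `s` is a leaf separation: the label of an edge from a leaf to its unique neighbour. -/
def STree.IsLeafSeparation {S : Set U} {F : Set (Set U)} (X : STree S F) (s : U) : Prop :=
  ∃ e : X.T.Dart, (∀ v, X.T.Adj e.fst v → v = e.snd) ∧ X.α e = s

end Basic

end SepUniverse

/-! Trees are handled through their edges: `Sprouts F x` says that a tree over `F` can be grown at
the head of an edge labelled `x`, and a whole tree is an edge that sprouts in both directions.

Tangle-tree duality (`tangle_or_hasTree`) is proved for a down-closed set `D` of permitted leaf
separations, by adding to `D` a minimal separation outside it. Either the new leaf can be avoided,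
or there is a half-tree growing from it. Two half-trees growing from nested separations are shifted
to a separation of least order between them, which emulates both, and glued there.

Apply this with `D` the small separations and those below members of `σ`. A tangle for these leaves
is a tangle for `σ`. Otherwise there is a tree whose new leaves lie below `σ`, and the members `s`
of `σ` are treated one at a time (`hasTree_leafSeps_insert`). Since `s` is essential, it
distinguishes tangles `P ∋ s` and `Q ∋ s*` efficiently. `Q` points to a leaf `z ≤ s`, efficiency
makes `s` emulate `z`, and the tree growing from `z` can be shifted to `s` and capped by `{s*}`. In
the final tree `Q` still points to some leaf star `{t*}` with `t ∈ σ`, and consistency forces `t =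
s`; so every `s` occurs as a leaf. -/

namespace SepUniverse

variable {U : Type*} [SepUniverse U]

/-! ### The involution and small separations. -/

theorem rev_injective : Function.Injective (rev : U → U) := fun a b h => by
  rw [← rev_rev a, h, rev_rev]

theorem le_rev_comm {a b : U} : a ≤ rev b ↔ b ≤ rev a :=
  ⟨fun h => by simpa [rev_rev] using rev_le_rev h, fun h => by simpa [rev_rev] using rev_le_rev h⟩

theorem rev_le_comm {a b : U} : rev a ≤ b ↔ rev b ≤ a :=
  ⟨fun h => by simpa [rev_rev] using rev_le_rev h, fun h => by simpa [rev_rev] using rev_le_rev h⟩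

theorem degenerate_rev {a : U} : Degenerate (rev a) ↔ Degenerate a := by
  simp only [Degenerate, rev_rev]; exact eq_comm

theorem Small.mono {a b : U} (hb : Small b) (h : a ≤ b) : Small a :=
  h.trans (hb.trans (rev_le_rev h))

theorem Degenerate.small {a : U} (h : Degenerate a) : Small a := le_of_eq h

theorem TrivialIn.small {S : Set U} {a : U} (h : TrivialIn S a) : Small a := by
  obtain ⟨s, -, h1, h2⟩ := h
  exact h1.le.trans (le_rev_comm.1 h2.le)

/-! ### Half-trees: gluing, removing leaves, shifting. -/

section Sprouts

/-- `x` is the label of an edge pointing to the root of a rooted tree of height less than `n`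
all of whose stars, including the one that this edge completes at the root, lie in `F`. -/
def SproutsWithin (F : Set (Set U)) : ℕ → U → Prop
  | 0, _ => False
  | n + 1, x => ∃ τ ∈ F, x ∈ τ ∧ ∀ y ∈ τ, y ≠ x → SproutsWithin F n (rev y)

/-- `x` is the label of an edge pointing to the root of a finite rooted tree over `F`. -/
def Sprouts (F : Set (Set U)) (x : U) : Prop := ∃ n, SproutsWithin F n x

/-- There is an edge with a finite tree over `F` on both of its sides. -/
def HasTree (F : Set (Set U)) : Prop := ∃ x, Sprouts F x ∧ Sprouts F (rev x)

/-- The set `F` enlarged by the leaf stars `{s*}` with `s ∈ L`. -/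
def withLeaves (F : Set (Set U)) (L : Set U) : Set (Set U) := F ∪ {τ | ∃ s ∈ L, τ = {rev s}}

theorem withLeaves_mono {F : Set (Set U)} {L M : Set U} (h : L ⊆ M) :
    withLeaves F L ⊆ withLeaves F M :=
  Set.union_subset_union_right _ fun _ ⟨s, hs, e⟩ => ⟨s, h hs, e⟩

variable {F G : Set (Set U)} {S : Set U}

theorem SproutsWithin.mono (hFG : F ⊆ G) {n : ℕ} {x : U} (h : SproutsWithin F n x) :
    SproutsWithin G n x := by
  induction n generalizing x with
  | zero => exact h.elim
  | succ n ih =>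
    obtain ⟨τ, hτ, hx, hy⟩ := h
    exact ⟨τ, hFG hτ, hx, fun y hyτ hyx => ih (hy y hyτ hyx)⟩

theorem Sprouts.mono (hFG : F ⊆ G) {x : U} : Sprouts F x → Sprouts G x :=
  fun ⟨n, h⟩ => ⟨n, h.mono hFG⟩

theorem HasTree.mono (hFG : F ⊆ G) : HasTree F → HasTree G :=
  fun ⟨x, h, h'⟩ => ⟨x, h.mono hFG, h'.mono hFG⟩

theorem SproutsWithin.succ {n : ℕ} {x : U} (h : SproutsWithin F n x) :
    SproutsWithin F (n + 1) x := by
  induction n generalizing x with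
  | zero => exact h.elim
  | succ n ih =>
    obtain ⟨τ, hτ, hx, hy⟩ := h
    exact ⟨τ, hτ, hx, fun y hyτ hyx => ih (hy y hyτ hyx)⟩

theorem SproutsWithin.of_le {m n : ℕ} (hmn : m ≤ n) {x : U} (h : SproutsWithin F m x) :
    SproutsWithin F n x := by
  induction hmn with
  | refl => exact h
  | step _ ih => exact ih.succ

theorem Sprouts.of_star {τ : Set U} (hfin : τ.Finite) (hτ : τ ∈ F) {x : U} (hx : x ∈ τ)
    (h : ∀ y ∈ τ, y ≠ x → Sprouts F (rev y)) : Sprouts F x := by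
  classical
  have h' : ∀ y ∈ τ, ∃ n, y ≠ x → SproutsWithin F n (rev y) := fun y hy => by
    by_cases hyx : y = x
    · exact ⟨0, fun h => (h hyx).elim⟩
    · obtain ⟨n, hn⟩ := h y hy hyx
      exact ⟨n, fun _ => hn⟩
  choose! f hf using h'
  refine ⟨hfin.toFinset.sup f + 1, τ, hτ, hx, fun y hy hyx => (hf y hy hyx).of_le ?_⟩
  exact Finset.le_sup (f := f) (hfin.mem_toFinset.2 hy)

theorem Sprouts.of_leaf {L : Set U} {z : U} (hz : z ∈ L) : Sprouts (withLeaves F L) (rev z) :=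
  ⟨1, {rev z}, Or.inr ⟨z, hz, rfl⟩, rfl, fun _ hy hyx => (hyx hy).elim⟩

/-- Across a star, the direction can be changed. -/
theorem Sprouts.turn {τ : Set U} (hfin : τ.Finite) (hτ : τ ∈ F) {x : U}
    (hx : Sprouts F (rev x)) (h : ∀ y ∈ τ, y ≠ x → Sprouts F (rev y)) {y : U} (hy : y ∈ τ) :
    Sprouts F y := by
  refine Sprouts.of_star hfin hτ hy fun z hz _ => ?_
  by_cases hzx : z = x
  · rwa [hzx]
  · exact h z hz hzx

/-- A tree that uses the leaf star `{r*}` contains a rooted tree without it, unless `r` is small. -/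
theorem Sprouts.remove_leaf {L : Set U} (hF : IsSetOfStars S F)
    {r : U} (hr : ¬ Small r) (h : Sprouts (withLeaves F (insert r L)) r) :
    Sprouts (withLeaves F L) r := by
  -- By the star property all labels directed away from the initial edge stay above `r`, so reaching
  -- the leaf star `{r*}` would give `r ≤ r*`.
  suffices ∀ n x, r ≤ x → SproutsWithin (withLeaves F (insert r L)) n x →
      SproutsWithin (withLeaves F L) n x from h.imp fun n => this n r le_rfl
  intro n
  induction n with
  | zero => exact fun _ _ h => h
  | succ n ih =>
    rintro x hrx ⟨τ, hτ | ⟨z, rfl | hz, rfl⟩, hx, hy⟩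
    · refine ⟨τ, Or.inl hτ, hx, fun y hyτ hyx => ih _ ?_ (hy y hyτ hyx)⟩
      exact hrx.trans ((hF τ hτ).2.2 x hx y hyτ (Ne.symm hyx))
    · exact (hr (hrx.trans_eq hx)).elim
    · exact ⟨{rev z}, Or.inr ⟨z, hz, rfl⟩, hx, fun y hyτ hyx => (hyx (hyτ.trans hx.symm)).elim⟩

/-- At a leaf with star `{r*}` the rest of the tree grows from `r`. So if `r` does not sprout, no
such leaf can occur, and the tree is already one with the smaller leaf set. -/
theorem HasTree.remove_leaf (hfin : S.Finite) {L : Set U} (hF : IsSetOfStars S F)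
    {r : U} (hr : ¬ Small r) (h : HasTree (withLeaves F (insert r L))) :
    HasTree (withLeaves F L) ∨ Sprouts (withLeaves F L) r := by
  by_cases hB : Sprouts (withLeaves F (insert r L)) r
  · exact Or.inr (hB.remove_leaf hF hr)
  have key : ∀ n x, SproutsWithin (withLeaves F (insert r L)) n x →
      Sprouts (withLeaves F (insert r L)) (rev x) → SproutsWithin (withLeaves F L) n x := by
    intro n
    induction n with
    | zero => exact fun _ h _ => h
    | succ n ih =>
      rintro x ⟨τ, hτ | ⟨z, rfl | hz, rfl⟩, hx, hy⟩ hx'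
      · refine ⟨τ, Or.inl hτ, hx, fun y hyτ hyx => ih _ (hy y hyτ hyx) ?_⟩
        rw [rev_rev]
        exact Sprouts.turn (hfin.subset (hF τ hτ).1) (Or.inl hτ) hx'
          (fun y hyτ hyx => ⟨n, hy y hyτ hyx⟩) hyτ
      · rw [Set.mem_singleton_iff] at hx
        rw [hx, rev_rev] at hx'
        exact (hB hx').elim
      · exact ⟨{rev z}, Or.inr ⟨z, hz, rfl⟩, hx, fun y hyτ hyx => (hyx (hyτ.trans hx.symm)).elim⟩
  obtain ⟨x, ⟨n, hn⟩, m, hm⟩ := h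
  refine Or.inl ⟨x, ⟨n, key n x hn ⟨m, hm⟩⟩, m, key m _ hm ?_⟩
  rw [rev_rev]
  exact ⟨n, hn⟩

/-- Shifting a rooted tree from `r` to a separation `s` that emulates `r`. -/
theorem Sprouts.shift (hF : IsSetOfStars S F) (hshift : ClosedUnderShifting S F)
    {L M : Set U} (hL : L ⊆ S) (hrev : ∀ x ∈ S, rev x ∈ S) {r s : U} (hrS : r ∈ S) (hsS : s ∈ S)
    (hr : ¬ Small r) (hem : Emulates S s r)
    (hLM : ∀ z ∈ L, r ≤ rev z → rev z ⊔ s ∈ S → rev (rev z ⊔ s) ∈ M ∨ {rev z ⊔ s} ∈ F)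
    (h : Sprouts (withLeaves F L) r) : Sprouts (withLeaves F M) s := by
  classical
  have hEF := (hshift r hrS s hsS (fun h => hr h.small) (fun h => hr h.small) hem).2
  -- A half-tree of least height never has `r*` in a later star: from there `r` would sprout with
  -- smaller height. This matters because shifting excludes stars containing `r*`.
  have hmin := fun m (hm : m < Nat.find h) => Nat.find_min h hm
  have hfind := Nat.find_spec h
  generalize Nat.find h = N at hmin hfind
  suffices ∀ n ≤ N, ∀ x, r ≤ x → SproutsWithin (withLeaves F L) n x →
      SproutsWithin (withLeaves F M) n (x ⊔ s) by
    have := this N le_rfl r le_rfl hfind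
    rw [sup_eq_right.2 hem.1] at this
    exact ⟨N, this⟩
  intro n
  induction n with
  | zero => exact fun _ _ _ h => h
  | succ n ih =>
    rintro hn x hrx ⟨τ, hτ | ⟨z, hz, rfl⟩, hx, hy⟩
    · have hle : ∀ y ∈ τ, y ≠ x → r ≤ rev y := fun y hyτ hyx =>
        hrx.trans ((hF τ hτ).2.2 x hx y hyτ (Ne.symm hyx))
      -- If `r` were below both `y` and `y*`, it would be small. Hence `shift` uses its second
      -- branch on every `y ≠ x`.
      have hnle : ∀ y ∈ τ, y ≠ x → ¬ r ≤ y := fun y hyτ hyx hry =>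
        hr (hry.trans (le_rev_comm.1 (hle y hyτ hyx)))
      refine ⟨_, Or.inl (hEF τ hτ (hF τ hτ).2 (fun y hyτ => ⟨⟨(hF τ hτ).1 hyτ, ?_⟩, ?_⟩)
        ⟨x, hx, hrx⟩), ⟨x, hx, by simp [SepUniverse.shift, hrx]⟩, ?_⟩
      · by_cases hyx : y = x
        · exact Or.inl (hyx ▸ hrx)
        · exact Or.inr (hle y hyτ hyx)
      · rintro (rfl : y = rev r)
        by_cases hyx : rev r = x
        · exact hr (hrx.trans_eq hyx.symm)
        · refine hmin n (by omega) ?_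
          simpa [rev_rev] using hy _ hyτ hyx
      · rintro _ ⟨y, hyτ, rfl⟩ hne
        have hyx : y ≠ x := by
          rintro rfl
          exact hne (by simp [SepUniverse.shift, hrx])
        simp only [SepUniverse.shift, hnle y hyτ hyx, if_false, rev_rev]
        exact ih (by omega) _ (hle y hyτ hyx) (hy y hyτ hyx)
    · obtain rfl : x = rev z := hx
      have hmem : rev z ⊔ s ∈ S := by
        rw [sup_comm]
        exact hem.2 _ (hrev _ (hL hz)) hrx fun e => hr (hrx.trans_eq e)
      refine ⟨{rev z ⊔ s}, ?_, rfl, fun y hyτ hyx => (hyx hyτ).elim⟩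
      refine (hLM z hz hrx hmem).elim (fun h => Or.inr ⟨_, h, by rw [rev_rev]⟩) Or.inl

/-- A tangle points to a leaf star of every tree that is not in its forbidden set. -/
theorem HasTree.exists_leaf (hfin : S.Finite) {L Q : Set U} (hF : IsSetOfStars S F)
    (hrev : ∀ x ∈ S, rev x ∈ S) (hL : L ⊆ S)
    (hQ : IsTangle S F Q) (h : HasTree (withLeaves F L)) :
    ∃ z ∈ L, rev z ∈ Q ∧ Sprouts (withLeaves F L) z := by
  -- Walk through the tree along edges oriented by `Q`: a star in `F` is not contained in `Q`, so
  -- there is always a way out until a leaf star is reached. The part already traversed is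
  -- remembered by `rev x` sprouting.
  have key : ∀ n x, x ∈ Q → SproutsWithin (withLeaves F L) n x →
      Sprouts (withLeaves F L) (rev x) → ∃ z ∈ L, rev z ∈ Q ∧ Sprouts (withLeaves F L) z := by
    intro n
    induction n with
    | zero => exact fun _ _ h _ => h.elim
    | succ n ih =>
      rintro x hxQ ⟨τ, hτ | ⟨z, hz, rfl⟩, hx, hy⟩ hx'
      · obtain ⟨y, hyτ, hyQ⟩ := Set.not_subset.1 (hQ.2.2 τ hτ)
        have hyx : y ≠ x := fun e => hyQ (e ▸ hxQ)
        refine ih (rev y) ((hQ.1.2 y ((hF τ hτ).1 hyτ)).1.resolve_left hyQ) (hy y hyτ hyx) ?_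
        rw [rev_rev]
        exact Sprouts.turn (hfin.subset (hF τ hτ).1) (Or.inl hτ) hx'
          (fun y hyτ hyx => ⟨n, hy y hyτ hyx⟩) hyτ
      · obtain rfl : x = rev z := hx
        exact ⟨z, hz, hxQ, by simpa [rev_rev] using hx'⟩
  obtain ⟨x, ⟨n, hn⟩, m, hm⟩ := h
  have hxS : x ∈ S := by
    cases n with
    | zero => exact hn.elim
    | succ n =>
      obtain ⟨τ, hτ | ⟨z, hz, rfl⟩, hx, -⟩ := hn
      · exact (hF τ hτ).1 hx
      · exact Set.mem_singleton_iff.1 hx ▸ hrev z (hL hz)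
  rcases (hQ.1.2 x hxS).1 with hx | hx
  · exact key n x hx hn ⟨m, hm⟩
  · exact key m _ hx hm (by rw [rev_rev]; exact ⟨n, hn⟩)

end Sprouts

/-! ### Tangle-tree duality with extra leaves. -/

section Duality

variable {ord : U → ℝ} {k : ℝ}

theorem IsOrderFunction.rev_mem_sepsBelow (hord : IsOrderFunction ord) (x : U)
    (hx : x ∈ sepsBelow ord k) : rev x ∈ sepsBelow ord k := (hord.symm x).trans_lt hx

/-- If no separation between `r` and `s` has smaller order than `s`, then `s` emulates `r`. -/
theorem IsOrderFunction.emulates (hord : IsOrderFunction ord) {r s : U} (hrs : r ≤ s)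
    (hmin : ∀ y, r ≤ y → y ≤ s → ord s ≤ ord y) : Emulates (sepsBelow ord k) s r := by
  refine ⟨hrs, fun t ht hrt _ => ?_⟩
  have h1 := hmin (s ⊓ t) (le_inf hrs hrt) inf_le_left
  have h2 := hord.submodular s t
  have h3 : ord t < k := ht
  show ord (s ⊔ t) < k
  linarith

/-- Any two comparable separations have between them one that emulates both of them. -/
theorem IsOrderFunction.exists_emulates (hord : IsOrderFunction ord)
    (hfin : (sepsBelow ord k).Finite) {r r' : U} (hr : r ∈ sepsBelow ord k) (hrr' : r ≤ r') :
    ∃ s ∈ sepsBelow ord k, Emulates (sepsBelow ord k) s r ∧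
      Emulates (sepsBelow ord k) (rev s) (rev r') := by
  obtain ⟨s, ⟨hsS, hrs, hsr'⟩, hs⟩ := Set.exists_min_image
    {x | x ∈ sepsBelow ord k ∧ r ≤ x ∧ x ≤ r'} ord (hfin.subset fun x hx => hx.1)
    ⟨r, hr, le_rfl, hrr'⟩
  have hs' : ∀ y, r ≤ y → y ≤ r' → ord s ≤ ord y := fun y h1 h2 => by
    by_cases hy : y ∈ sepsBelow ord k
    · exact hs y ⟨hy, h1, h2⟩
    · exact (show ord s < k from hsS).le.trans (not_lt.1 hy)
  refine ⟨s, hsS, hord.emulates hrs fun y h1 h2 => hs' y h1 (h2.trans hsr'),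
    hord.emulates (rev_le_rev hsr') fun y h1 h2 => ?_⟩
  rw [hord.symm, ← hord.symm y]
  exact hs' _ (hrs.trans (le_rev_comm.1 h2)) (rev_le_comm.1 h1)

/-- The non-degenerate elements of a set. -/
def nondeg (D : Set U) : Set U := {x | x ∈ D ∧ ¬ Degenerate x}

variable {S : Set U} {F : Set (Set U)}

theorem IsTangle.mono {G : Set (Set U)} (hFG : F ⊆ G) {O : Set U} (h : IsTangle S G O) :
    IsTangle S F O := ⟨h.1, h.2.1, fun τ hτ => h.2.2 τ (hFG hτ)⟩

theorem nondeg_insert_subset {D : Set U} (r : U) :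
    nondeg (insert r D) ⊆ insert r (nondeg D) := by
  rintro x ⟨rfl | hx, h⟩
  · exact Or.inl rfl
  · exact Or.inr ⟨hx, h⟩

/-- A down-closed set that decides every separation is a tangle or gives rise to a tree. -/
theorem tangle_or_hasTree_of_decides (hfin : S.Finite) (hF : IsSetOfStars S F) (hF0 : ∅ ∉ F)
    (hrev : ∀ x ∈ S, rev x ∈ S) {D : Set U} (hDS : D ⊆ S) (hsmall : ∀ x ∈ S, Small x → x ∈ D)
    (hdown : ∀ x ∈ S, ∀ y ∈ D, x ≤ y → x ∈ D) (hdec : ∀ x ∈ S, x ∈ D ∨ rev x ∈ D) :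
    (∃ O, IsTangle S (withLeaves F (nondeg D)) O) ∨ HasTree (withLeaves F (nondeg D)) := by
  by_cases h1 : ∃ x ∈ D, rev x ∈ D ∧ ¬ Degenerate x
  · obtain ⟨x, hx, hx', hxd⟩ := h1
    refine Or.inr ⟨x, ?_, Sprouts.of_leaf ⟨hx, hxd⟩⟩
    have := Sprouts.of_leaf (F := F) (L := nondeg D) (z := rev x) ⟨hx', by rwa [degenerate_rev]⟩
    rwa [rev_rev] at this
  push Not at h1
  by_cases h2 : ∃ τ ∈ F, τ ⊆ D
  · obtain ⟨τ, hτ, hτD⟩ := h2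
    have hleaf : ∀ y ∈ τ, Sprouts (withLeaves F (nondeg D)) (rev y) := fun y hy =>
      Sprouts.of_leaf ⟨hτD hy, (hF τ hτ).2.1 y hy⟩
    obtain ⟨x, hx⟩ : τ.Nonempty := Set.nonempty_iff_ne_empty.2 fun e => hF0 (e ▸ hτ)
    exact Or.inr ⟨x, Sprouts.of_star (hfin.subset (hF τ hτ).1) (Or.inl hτ) hx
      fun y hy _ => hleaf y hy, hleaf x hx⟩
  push Not at h2
  refine Or.inl ⟨D, ⟨hDS, fun s hs => ⟨hdec s hs, h1 s⟩⟩, ?_, ?_⟩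
  -- A violation of consistency makes `r` degenerate, as `D` is down-closed; then `s* ≤ r < s`, so
  -- `s*` is small and lies in `D`, and `s` is degenerate too, contradicting `r < s`.
  · rintro r s hrs hne ⟨hr, hs⟩
    have hrS : r ∈ S := by simpa [rev_rev] using hrev _ (hDS hr)
    have hrd := h1 r (hdown r hrS s hs hrs.le) hr
    have hsr : rev s ≤ r := (rev_le_rev hrs.le).trans_eq hrd.symm
    have hsd := h1 s hs (hsmall _ (hrev s (hDS hs)) (by
      rw [Small, rev_rev]; exact hsr.trans hrs.le))
    exact hrs.not_ge (hsd.le.trans hsr)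
  · rintro τ (hτ | ⟨z, hz, rfl⟩)
    · exact h2 τ hτ
    · exact fun h => hz.2 (h1 z hz.1 (h rfl))

/-- Tangle-tree duality, with leaf stars for all separations in a down-closed set. -/
theorem tangle_or_hasTree (hord : IsOrderFunction ord) (hfin : (sepsBelow ord k).Finite)
    (hF : IsSetOfStars (sepsBelow ord k) F) (hF0 : ∅ ∉ F)
    (hshift : ClosedUnderShifting (sepsBelow ord k) F) {D : Set U} (hDS : D ⊆ sepsBelow ord k)
    (hsmall : ∀ x ∈ sepsBelow ord k, Small x → x ∈ D)
    (hdown : ∀ x ∈ sepsBelow ord k, ∀ y ∈ D, x ≤ y → x ∈ D) :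
    (∃ O, IsTangle (sepsBelow ord k) (withLeaves F (nondeg D)) O) ∨
      HasTree (withLeaves F (nondeg D)) := by
  have hrev := hord.rev_mem_sepsBelow (k := k)
  obtain ⟨n, hn⟩ : ∃ n, (sepsBelow ord k \ D).ncard = n := ⟨_, rfl⟩
  induction n using Nat.strong_induction_on generalizing D with
  | _ n ih =>
  by_cases hdec : ∀ x ∈ sepsBelow ord k, x ∈ D ∨ rev x ∈ D
  · exact tangle_or_hasTree_of_decides hfin hF hF0 hrev hDS hsmall hdown hdec
  push Not at hdec
  obtain ⟨r₀, hr₀, hr₀D, hr₀D'⟩ := hdec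
  -- Minimality of `r` outside `D` keeps `insert r D` down-closed, so the induction applies to it.
  have hstep : ∀ x ∈ sepsBelow ord k, x ∉ D →
      (∃ O, IsTangle (sepsBelow ord k) (withLeaves F (nondeg D)) O) ∨
      HasTree (withLeaves F (nondeg D)) ∨
      ∃ r ∈ sepsBelow ord k, r ≤ x ∧ ¬ Small r ∧ Sprouts (withLeaves F (nondeg D)) r := by
    intro x hx hxD
    obtain ⟨r, hrx, hr⟩ := (hfin.sdiff (t := D)).exists_le_minimal ⟨hx, hxD⟩
    have hrsm : ¬ Small r := fun h => hr.1.2 (hsmall r hr.1.1 h)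
    have hlt : (sepsBelow ord k \ insert r D).ncard < n := by
      rw [← hn]
      refine Set.ncard_lt_ncard ⟨Set.sdiff_subset_sdiff_right (Set.subset_insert _ _), fun h => ?_⟩
        hfin.sdiff
      exact (h hr.1).2 (Set.mem_insert _ _)
    have hdown' : ∀ y ∈ sepsBelow ord k, ∀ z ∈ insert r D, y ≤ z → y ∈ insert r D := by
      rintro y hy z (rfl | hz) hyz
      · by_cases hyD : y ∈ D
        · exact Or.inr hyD
        · exact Or.inl (le_antisymm hyz (hr.2 ⟨hy, hyD⟩ hyz))
      · exact Or.inr (hdown y hy z hz hyz)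
    have hsub : nondeg D ⊆ nondeg (insert r D) := fun y hy => ⟨Or.inr hy.1, hy.2⟩
    rcases ih _ hlt (D := insert r D) (Set.insert_subset hr.1.1 hDS)
      (fun y hy h => Or.inr (hsmall y hy h)) hdown' rfl with ⟨O, hO⟩ | h
    · exact Or.inl ⟨O, hO.mono (withLeaves_mono hsub)⟩
    · refine Or.inr (((h.mono (withLeaves_mono (nondeg_insert_subset r))).remove_leaf hfin hF
        hrsm).imp id fun h => ⟨r, hr.1.1, hrx, hrsm, h⟩)
  rcases hstep r₀ hr₀ hr₀D with h | h | ⟨r, hrS, hr, hrsm, hBr⟩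
  · exact Or.inl h
  · exact Or.inr h
  rcases hstep _ (hrev _ hr₀) hr₀D' with h | h | ⟨r', hrS', hr', hrsm', hBr'⟩
  · exact Or.inl h
  · exact Or.inr h
  obtain ⟨s, hs, h1, h2⟩ := hord.exists_emulates hfin hrS (hr.trans (le_rev_comm.1 hr'))
  rw [rev_rev] at h2
  -- Shifting only lowers leaf separations, so they stay in the down-closed set `D`; they stay
  -- non-degenerate because `r` is not small.
  have key : ∀ {r s : U}, r ∈ sepsBelow ord k → s ∈ sepsBelow ord k → ¬ Small r →
      Emulates (sepsBelow ord k) s r → Sprouts (withLeaves F (nondeg D)) r →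
      Sprouts (withLeaves F (nondeg D)) s := by
    intro r s hr hs hrsm hem
    refine Sprouts.shift hF hshift (fun x hx => hDS hx.1) hrev hr hs hrsm hem ?_
    refine fun z hz hrz hzs => Or.inl ⟨hdown _ (hrev _ hzs) z hz.1 ?_, ?_⟩
    · exact rev_le_comm.1 le_sup_left
    · rw [degenerate_rev]
      exact fun hd => hrsm (hd.small.mono (hem.1.trans le_sup_right))
  exact Or.inr ⟨s, key hrS hs hrsm h1 hBr, key hrS' (hrev s hs) hrsm' h2 hBr'⟩

/-! ### Moving the leaves onto the star of essential separations. -/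

/-- If `s` distinguishes the tangles `P` and `Q` efficiently, then it emulates every separation
below it whose inverse lies in the tangle that contains the inverse of `s`. -/
theorem emulates_of_distinguishesEfficiently (hord : IsOrderFunction ord)
    (hcosmall : ∀ r ∈ sepsBelow ord k, CoSmall r → ¬ Degenerate r → {r} ∈ F) {P Q : Set U}
    (hP : IsTangle (sepsBelow ord k) F P) (hQ : IsTangle (sepsBelow ord k) F Q) {s z : U}
    (hs : DistinguishesEfficiently ord (sepsBelow ord k) s P Q) (hsP : s ∈ P)
    (hz : rev z ∈ Q) (hzs : z ≤ s) (hzd : ¬ Degenerate z) : Emulates (sepsBelow ord k) s z := by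
  -- A separation `y` of smaller order between `z` and `s` would also distinguish `P` from `Q`,
  -- contradicting efficiency.
  refine hord.emulates hzs fun y hzy hys => not_lt.1 fun hlt => ?_
  have hyS : y ∈ sepsBelow ord k := hlt.trans hs.1
  refine hlt.not_ge (hs.2.2 y hyS (Or.inl ⟨?_, ?_⟩))
  · refine ((hP.1.2 y hyS).1).resolve_right fun h => ?_
    refine hP.2.1 y s (lt_of_le_of_ne hys fun e => ?_) (fun e => ?_) ⟨h, hsP⟩
    · exact hlt.ne (congrArg ord e)
    · exact hlt.ne ((congrArg ord e).trans (hord.symm s))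
  · refine ((hQ.1.2 y hyS).1).resolve_left fun h => ?_
    rcases hzy.eq_or_lt with rfl | hlt'
    · exact hzd ((hQ.1.2 z hyS).2 h hz)
    -- Consistency says nothing about two orientations of one separation; here `y` is co-small, and
    -- `{y} ∈ F` excludes it from `Q`.
    · by_cases e : z = rev y
      · refine hQ.2.2 _ (hcosmall y hyS ?_ ?_) (Set.singleton_subset_iff.2 h)
        · rw [CoSmall, Small, rev_rev, ← e]
          exact hzy
        · rw [← degenerate_rev, ← e]
          exact hzd
      · exact hQ.2.1 z y hlt' e ⟨hz, h⟩

/-- A separation in the star `σ` that a tangle orients against `s ∈ σ` lies below `s`. -/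
theorem le_of_rev_mem_tangle {Q σ : Set U} (hQ : IsTangle S F Q) (hσ : IsStar σ) {s t z : U}
    (hsS : s ∈ S) (hs : s ∈ σ) (ht : t ∈ σ) (hsQ : rev s ∈ Q) (hzQ : rev z ∈ Q) (hzt : z ≤ t) :
    z ≤ s := by
  by_cases hts : t = s
  · exact hts ▸ hzt
  have hzs : z ≤ rev s := hzt.trans (hσ.2 t ht s hs hts)
  -- Now `z ≤ s*` while `Q` contains `z*` and `s*`. Consistency leaves only `z = s*`, which would
  -- make `s` degenerate, or `z = s`.
  by_contra hne
  rcases hzs.eq_or_lt with rfl | hlt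
  · rw [rev_rev] at hzQ
    exact hσ.1 s hs ((hQ.1.2 s hsS).2 hzQ hsQ)
  · refine hQ.2.1 z (rev s) hlt (fun e => hne ?_) ⟨hzQ, hsQ⟩
    rw [e, rev_rev]

/-- The leaf separations allowed once the separations in `J` have been dealt with. -/
def leafSeps (S σ J : Set U) : Set U :=
  J ∪ {x | x ∈ S ∧ ¬ Degenerate x ∧ ∃ s ∈ σ, s ∉ J ∧ x ≤ s}

/-- The inductive step: the part of the tree growing from the leaf to which `Q` points is kept and
shifted to `s`; the other side becomes the single leaf star `{s*}`. -/
theorem hasTree_leafSeps_insert (hord : IsOrderFunction ord) (hfin : (sepsBelow ord k).Finite)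
    (hF : IsSetOfStars (sepsBelow ord k) F)
    (hcosmall : ∀ r ∈ sepsBelow ord k, CoSmall r → ¬ Degenerate r → {r} ∈ F)
    (hshift : ClosedUnderShifting (sepsBelow ord k) F) {σ : Set U}
    (hσS : σ ⊆ sepsBelow ord k) (hσ : IsStar σ) {J : Set U} (hJ : J ⊆ σ) {s : U} (hs : s ∈ σ)
    (hsJ : s ∉ J) {P Q : Set U} (hP : IsTangle (sepsBelow ord k) F P)
    (hQ : IsTangle (sepsBelow ord k) F Q)
    (hPQ : DistinguishesEfficiently ord (sepsBelow ord k) s P Q) (hsP : s ∈ P) (hsQ : rev s ∈ Q)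
    (h : HasTree (withLeaves F (leafSeps (sepsBelow ord k) σ J))) :
    HasTree (withLeaves F (leafSeps (sepsBelow ord k) σ (insert s J))) := by
  have hrev := hord.rev_mem_sepsBelow (k := k)
  have hLS : leafSeps (sepsBelow ord k) σ J ⊆ sepsBelow ord k :=
    Set.union_subset (hJ.trans hσS) fun x hx => hx.1
  obtain ⟨z, hz, hzQ, hBz⟩ := h.exists_leaf hfin hF hrev hLS hQ
  have hzS := hLS hz
  have hzd : ¬ Degenerate z := hz.elim (fun h => hσ.1 z (hJ h)) fun h => h.2.1
  obtain ⟨t, ht, hzt⟩ : ∃ t ∈ σ, z ≤ t :=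
    hz.elim (fun h => ⟨z, hJ h, le_rfl⟩) fun ⟨_, _, t, ht, _, h⟩ => ⟨t, ht, h⟩
  have hzs := le_of_rev_mem_tangle hQ hσ (hσS hs) hs ht hsQ hzQ hzt
  have hnsmall : ∀ x ∈ sepsBelow ord k, rev x ∈ Q → ¬ Degenerate x → ¬ Small x :=
    fun x hx hxQ hxd hsm => hQ.2.2 _ (hcosmall _ (hrev x hx) (by rwa [CoSmall, rev_rev])
      (by rwa [degenerate_rev])) (Set.singleton_subset_iff.2 hxQ)
  have hssm := hnsmall s (hσS hs) hsQ (hσ.1 s hs)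
  refine ⟨s, ?_, Sprouts.of_leaf (Or.inl (Or.inl rfl))⟩
  refine Sprouts.shift hF hshift hLS hrev hzS (hσS hs) (hnsmall z hzS hzQ hzd)
    (emulates_of_distinguishesEfficiently hord hcosmall hP hQ hPQ hsP hzQ hzs hzd) ?_ hBz
  intro y hy _ hyS
  have hnd : ¬ Degenerate (rev y ⊔ s) := fun hd => hssm (hd.small.mono le_sup_right)
  have hle : rev (rev y ⊔ s) ≤ y := rev_le_comm.1 le_sup_left
  -- Three kinds of leaves: those in `J` are fixed, since `s ≤ y*`; those below `s` acquire a
  -- co-small star, which lies in `F`; those below another member `t` remain below `t`.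
  rcases hy with hy | ⟨_, _, t, ht, htJ, hyt⟩
  · have hys : s ≤ rev y := hσ.2 s hs y (hJ hy) fun e => hsJ (e ▸ hy)
    rw [sup_eq_left.2 hys, rev_rev]
    exact Or.inl (Or.inl (Or.inr hy))
  · by_cases hts : t = s
    · refine Or.inr (hcosmall _ hyS ?_ hnd)
      rw [CoSmall, Small, rev_rev]
      exact hle.trans (hyt.trans (hts.le.trans le_sup_right))
    · exact Or.inl (Or.inr ⟨hrev _ hyS, by rwa [degenerate_rev], t, ht,
        fun h => h.elim hts htJ, hle.trans hyt⟩)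

/-- For a star of essential separations there is a tangle that contains them all, or a tree all
of whose new leaf stars come from the star. -/
theorem tangle_or_hasTree_star (hord : IsOrderFunction ord) (hfin : (sepsBelow ord k).Finite)
    (hF : IsSetOfStars (sepsBelow ord k) F) (hF0 : ∅ ∉ F)
    (hcosmall : ∀ r ∈ sepsBelow ord k, CoSmall r → ¬ Degenerate r → {r} ∈ F)
    (hshift : ClosedUnderShifting (sepsBelow ord k) F) {σ : Set U}
    (hσS : σ ⊆ sepsBelow ord k) (hσ : IsStar σ)
    (hess : ∀ s ∈ σ, ∃ P Q, IsTangle (sepsBelow ord k) F P ∧ IsTangle (sepsBelow ord k) F Q ∧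
      DistinguishesEfficiently ord (sepsBelow ord k) s P Q ∧ s ∈ P ∧ rev s ∈ Q) :
    (∃ O, IsTangle (sepsBelow ord k) (withLeaves F σ) O) ∨ HasTree (withLeaves F σ) := by
  have hrev := hord.rev_mem_sepsBelow (k := k)
  rcases tangle_or_hasTree hord hfin hF hF0 hshift
    (D := {x | x ∈ sepsBelow ord k ∧ (Small x ∨ ∃ s ∈ σ, x ≤ s)}) (fun x hx => hx.1)
    (fun x hx h => ⟨hx, Or.inl h⟩)
    (fun x hx y hy hxy => ⟨hx, hy.2.imp (fun h => h.mono hxy)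
      fun ⟨s, hs, h⟩ => ⟨s, hs, hxy.trans h⟩⟩) with ⟨O, hO⟩ | h
  · refine Or.inl ⟨O, hO.mono (withLeaves_mono (M := nondeg _) fun s hs => ?_)⟩
    exact ⟨⟨hσS hs, Or.inr ⟨s, hs, le_rfl⟩⟩, hσ.1 s hs⟩
  · right
    have key : ∀ J ⊆ σ, HasTree (withLeaves F (leafSeps (sepsBelow ord k) σ J)) := by
      intro J hJ
      induction J, (hfin.subset (hJ.trans hσS)) using Set.Finite.induction_on with
      | empty =>
        refine h.mono ?_
        -- Leaf stars of small separations are co-small singletons, hence already in `F`.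
        rintro τ (hτ | ⟨z, ⟨⟨hzS, hz⟩, hzd⟩, rfl⟩)
        · exact Or.inl hτ
        · rcases hz with hz | ⟨s, hs, hzs⟩
          · exact Or.inl (hcosmall _ (hrev z hzS) (by rwa [CoSmall, rev_rev])
              (by rwa [degenerate_rev]))
          · exact Or.inr ⟨z, Or.inr ⟨hzS, hzd, s, hs, fun h => h, hzs⟩, rfl⟩
      | @insert s J hsJ _ ih =>
        obtain ⟨P, Q, hP, hQ, hPQ, hsP, hsQ⟩ := hess s (hJ (Set.mem_insert _ _))
        have hJ' := (Set.subset_insert s J).trans hJ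
        exact hasTree_leafSeps_insert hord hfin hF hcosmall hshift hσS hσ hJ'
          (hJ (Set.mem_insert _ _)) hsJ hP hQ hPQ hsP hsQ (ih hJ')
    refine (key σ subset_rfl).mono (withLeaves_mono (Set.union_subset subset_rfl ?_))
    rintro x ⟨_, _, s, hs, hs', _⟩
    exact (hs' hs).elim

end Duality

/-! ### From half-trees to graph-theoretic trees. -/

section Trees

/-- A finite rooted tree given by its parent function; `label v` is the label of the edge from
`v` to its parent. The star at every vertex other than the root lies in `F`, and `C` is the set
of labels of the edges pointing to the root. Distinct edges at a vertex have distinct labels. -/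
structure RootedTree (F : Set (Set U)) (C : Set U) where
  V : Type
  finite_V : Finite V
  root : V
  parent : V → V
  depth : V → ℕ
  depth_parent : ∀ v, v ≠ root → depth v = depth (parent v) + 1
  label : V → U
  child_inj : ∀ v w, v ≠ root → w ≠ root → parent v = parent w → label v = label w → v = w
  label_ne : ∀ v, v ≠ root → parent v ≠ root → label v ≠ rev (label (parent v))
  star_mem : ∀ v, v ≠ root →
    insert (rev (label v)) {x | ∃ w, w ≠ root ∧ parent w = v ∧ label w = x} ∈ F
  root_star : {x | ∃ w, w ≠ root ∧ parent w = root ∧ label w = x} = C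

namespace RootedTree

variable {F : Set (Set U)}

section Join

variable {ι : Type} (c : ι → U) {D : ι → Set U} (X : ∀ i, RootedTree F (D i))

open Classical in
/-- The parent function of the tree obtained by joining rooted trees at a new root. -/
noncomputable def joinParent : Option (Σ i, (X i).V) → Option (Σ i, (X i).V)
  | none => none
  | some ⟨i, v⟩ => if v = (X i).root then none else some ⟨i, (X i).parent v⟩

open Classical in
/-- The labels of the tree obtained by joining rooted trees at a new root. -/
noncomputable def joinLabel (d : U) : Option (Σ i, (X i).V) → U
  -- The new root has no parent edge, so `d` is a dummy value.
  | none => d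
  | some ⟨i, v⟩ => if v = (X i).root then c i else (X i).label v

/-- The depth function of the tree obtained by joining rooted trees at a new root. -/
def joinDepth : Option (Σ i, (X i).V) → ℕ
  | none => 0
  -- Roots need not have depth `0`. The truncated subtraction is harmless by `depth_root_le`.
  | some ⟨i, v⟩ => (X i).depth v - (X i).depth (X i).root + 1

theorem depth_root_le {C : Set U} (Y : RootedTree F C) (v : Y.V) : Y.depth Y.root ≤ Y.depth v := by
  obtain ⟨n, hn⟩ : ∃ n, Y.depth v = n := ⟨_, rfl⟩
  induction n generalizing v with
  | zero =>
    by_cases h : v = Y.root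
    · rw [h]
    · have := Y.depth_parent v h
      omega
  | succ n ih =>
    by_cases h : v = Y.root
    · rw [h]
    · have := Y.depth_parent v h
      have := ih (Y.parent v) (by omega)
      omega

theorem joinParent_root (i : ι) : joinParent X (some ⟨i, (X i).root⟩) = none := by
  simp [joinParent]

theorem joinParent_of_ne {i : ι} {v : (X i).V} (h : v ≠ (X i).root) :
    joinParent X (some ⟨i, v⟩) = some ⟨i, (X i).parent v⟩ := by
  simp [joinParent, h]

theorem joinLabel_root (d : U) (i : ι) : joinLabel c X d (some ⟨i, (X i).root⟩) = c i := by
  simp [joinLabel]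

theorem joinLabel_of_ne (d : U) {i : ι} {v : (X i).V} (h : v ≠ (X i).root) :
    joinLabel c X d (some ⟨i, v⟩) = (X i).label v := by
  simp [joinLabel, h]

/-- The labels of the edges pointing to a vertex `v` of one of the joined trees from below. -/
theorem joinLabel_children (d : U) (i : ι) (v : (X i).V) :
    {x | ∃ w, w ≠ none ∧ joinParent X w = some ⟨i, v⟩ ∧ joinLabel c X d w = x} =
      {x | ∃ w, w ≠ (X i).root ∧ (X i).parent w = v ∧ (X i).label w = x} := by
  ext x
  constructor
  · rintro ⟨_ | ⟨j, w⟩, hw, hp, hl⟩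
    · exact (hw rfl).elim
    · by_cases h : w = (X j).root
      · subst h
        simp [joinParent_root] at hp
      · rw [joinParent_of_ne X h] at hp
        obtain ⟨rfl, hp⟩ := Sigma.mk.inj (Option.some.inj hp)
        rw [joinLabel_of_ne c X d h] at hl
        exact ⟨w, h, eq_of_heq hp, hl⟩
  · rintro ⟨w, h, rfl, rfl⟩
    exact ⟨some ⟨i, w⟩, by simp, joinParent_of_ne X h, joinLabel_of_ne c X d h⟩

/-- Joining finitely many rooted trees at a new root. -/
noncomputable def join [Finite ι] (d : U) (hc : Function.Injective c) (hD : ∀ i, rev (c i) ∉ D i)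
    (hDF : ∀ i, insert (rev (c i)) (D i) ∈ F) : RootedTree F (Set.range c) where
  V := Option (Σ i, (X i).V)
  finite_V := by
    have := fun i => (X i).finite_V
    infer_instance
  root := none
  parent := joinParent X
  depth := joinDepth X
  depth_parent := by
    rintro (_ | ⟨i, v⟩) hv
    · exact (hv rfl).elim
    · by_cases h : v = (X i).root
      · subst h
        simp [joinParent_root, joinDepth]
      · have h1 := (X i).depth_parent v h
        have h2 := (X i).depth_root_le ((X i).parent v)
        simp only [joinParent_of_ne X h, joinDepth]
        omega
  label := joinLabel c X d
  child_inj := by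
    rintro (_ | ⟨i, v⟩) (_ | ⟨j, w⟩) hv hw hp hl
    · rfl
    · exact (hv rfl).elim
    · exact (hw rfl).elim
    · by_cases h : v = (X i).root
      · subst h
        by_cases h' : w = (X j).root
        · subst h'
          rw [joinLabel_root, joinLabel_root] at hl
          rw [hc hl]
        · simp [joinParent_root, joinParent_of_ne X h'] at hp
      · by_cases h' : w = (X j).root
        · subst h'
          simp [joinParent_root, joinParent_of_ne X h] at hp
        · rw [joinParent_of_ne X h, joinParent_of_ne X h'] at hp
          obtain ⟨rfl, hp⟩ := Sigma.mk.inj (Option.some.inj hp)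
          rw [joinLabel_of_ne c X d h, joinLabel_of_ne c X d h'] at hl
          rw [(X i).child_inj v w h h' (eq_of_heq hp) hl]
  label_ne := by
    rintro (_ | ⟨i, v⟩) hv hp
    · exact (hv rfl).elim
    · by_cases h : v = (X i).root
      · subst h
        exact (hp (joinParent_root X i)).elim
      · rw [joinParent_of_ne X h, joinLabel_of_ne c X d h]
        by_cases h' : (X i).parent v = (X i).root
        · rw [h', joinLabel_root]
          intro e
          refine hD i ?_
          rw [← e]
          exact (X i).root_star.subset ⟨v, h, h', rfl⟩
        · rw [joinLabel_of_ne c X d h']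
          exact (X i).label_ne v h h'
  star_mem := by
    rintro (_ | ⟨i, v⟩) hv
    · exact (hv rfl).elim
    · rw [joinLabel_children]
      by_cases h : v = (X i).root
      · subst h
        rw [(X i).root_star, joinLabel_root]
        exact hDF i
      · rw [joinLabel_of_ne c X d h]
        exact (X i).star_mem v h
  root_star := by
    ext x
    constructor
    · rintro ⟨_ | ⟨i, v⟩, hv, hp, hl⟩
      · exact (hv rfl).elim
      · by_cases h : v = (X i).root
        · subst h
          exact ⟨i, by rw [← hl, joinLabel_root]⟩
        · simp [joinParent_of_ne X h] at hp
    · rintro ⟨i, rfl⟩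
      exact ⟨some ⟨i, (X i).root⟩, by simp, joinParent_root X i, joinLabel_root c X d i⟩

end Join

theorem exists_of_star (d : U) {C : Set U} (hC : C.Finite)
    (h : ∀ y ∈ C, ∃ D, rev y ∉ D ∧ insert (rev y) D ∈ F ∧ Nonempty (RootedTree F D)) :
    Nonempty (RootedTree F C) := by
  have := hC.to_subtype
  -- Indexing by `Fin` keeps the vertex type in `Type`, whatever the universe of `U`.
  let e := (Finite.equivFin C).symm
  have h' : ∀ i, ∃ D, rev (e i : U) ∉ D ∧ insert (rev (e i : U)) D ∈ F ∧
      Nonempty (RootedTree F D) := fun i => h _ (e i).2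
  choose D h1 h2 h3 using h'
  have := join (fun i => (e i : U)) (fun i => (h3 i).some) d
    (Subtype.val_injective.comp e.injective) h1 h2
  rw [show Set.range (fun i => (e i : U)) = C by
    rw [← Function.comp_def, e.surjective.range_comp, Subtype.range_coe]] at this
  exact ⟨this⟩

end RootedTree

/-- One child is kept for each element of `τ \ {x}`. This makes the labels at a vertex distinct, so
that a singleton star later means a leaf. -/
theorem Sprouts.exists_rootedTree {F : Set (Set U)} (hF : ∀ τ ∈ F, τ.Finite) {x : U}
    (h : Sprouts F x) : ∃ D, x ∉ D ∧ insert x D ∈ F ∧ Nonempty (RootedTree F D) := by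
  obtain ⟨n, h⟩ := h
  induction n generalizing x with
  | zero => exact h.elim
  | succ n ih =>
    obtain ⟨τ, hτ, hx, hy⟩ := h
    refine ⟨τ \ {x}, fun h => h.2 rfl, ?_, RootedTree.exists_of_star x (hF τ hτ).sdiff
      fun y hyτ => ih (hy y hyτ.1 hyτ.2)⟩
    rwa [Set.insert_sdiff_singleton, Set.insert_eq_of_mem hx]

theorem HasTree.exists_rootedTree {F : Set (Set U)} (hF : ∀ τ ∈ F, τ.Finite) (h : HasTree F) :
    ∃ C ∈ F, C.Nonempty ∧ Nonempty (RootedTree F C) := by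
  obtain ⟨x, ⟨_ | n, h⟩, hx⟩ := h
  · exact h.elim
  obtain ⟨τ, hτ, hxτ, hy⟩ := h
  refine ⟨τ, hτ, ⟨x, hxτ⟩, RootedTree.exists_of_star x (hF τ hτ) fun y hyτ => ?_⟩
  refine Sprouts.exists_rootedTree hF ?_
  by_cases hyx : y = x
  · rwa [hyx]
  · exact ⟨n, hy y hyτ hyx⟩

namespace RootedTree

variable {F : Set (Set U)} {C : Set U} (X : RootedTree F C)

/-- The underlying graph of a rooted tree. -/
def graph : SimpleGraph X.V where
  Adj v w := (v ≠ X.root ∧ X.parent v = w) ∨ (w ≠ X.root ∧ X.parent w = v)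
  symm := ⟨fun _ _ h => h.symm⟩
  loopless := ⟨fun v h => by
    have hv : v ≠ X.root ∧ X.parent v = v := h.elim id id
    have := X.depth_parent v hv.1
    rw [hv.2] at this
    omega⟩

theorem not_both {v w : X.V} (h : v ≠ X.root ∧ X.parent v = w)
    (h' : w ≠ X.root ∧ X.parent w = v) : False := by
  have h1 := X.depth_parent v h.1
  have h2 := X.depth_parent w h'.1
  rw [h.2] at h1
  rw [h'.2] at h2
  omega

theorem connected_graph : X.graph.Connected := by
  have h : ∀ n v, X.depth v = n → X.graph.Reachable v X.root := by
    intro n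
    induction n with
    | zero =>
      intro v hv
      by_cases h : v = X.root
      · rw [h]
      · have := X.depth_parent v h
        omega
    | succ n ih =>
      intro v hv
      by_cases h : v = X.root
      · rw [h]
      · have hd := X.depth_parent v h
        have hadj : X.graph.Adj v (X.parent v) := Or.inl ⟨h, rfl⟩
        exact hadj.reachable.trans (ih _ (by omega))
  exact { preconnected := fun v w => (h _ v rfl).trans (h _ w rfl).symm, nonempty := ⟨X.root⟩ }

theorem isTree_graph : X.graph.IsTree := by
  have := X.finite_V
  rw [SimpleGraph.isTree_iff_connected_and_card]
  refine ⟨X.connected_graph, ?_⟩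
  -- Edges correspond to non-root vertices via `v ↦ {v, parent v}`, giving one edge fewer than
  -- vertices.
  have hrange : X.graph.edgeSet = (fun v => s(v, X.parent v)) '' {X.root}ᶜ := by
    ext e
    induction e using Sym2.ind with
    | _ v w =>
    rw [SimpleGraph.mem_edgeSet]
    constructor
    · rintro (⟨h, rfl⟩ | ⟨h, rfl⟩)
      · exact ⟨v, h, rfl⟩
      · exact ⟨w, h, Sym2.eq_swap⟩
    · rintro ⟨u, hu, he⟩
      rcases Sym2.eq_iff.1 he with ⟨rfl, rfl⟩ | ⟨rfl, rfl⟩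
      · exact Or.inl ⟨hu, rfl⟩
      · exact Or.inr ⟨hu, rfl⟩
  have hinj : Set.InjOn (fun v => s(v, X.parent v)) {X.root}ᶜ := by
    intro v hv w hw he
    rcases Sym2.eq_iff.1 he with ⟨h, -⟩ | ⟨h, h'⟩
    · exact h
    · exact (X.not_both ⟨hv, h'⟩ ⟨hw, h.symm⟩).elim
  rw [Nat.card_coe_set_eq, hrange, hinj.ncard_image, ← Set.ncard_singleton X.root, add_comm,
    Set.ncard_add_ncard_compl]

open Classical in
/-- The labels of the oriented edges. -/
noncomputable def dartLabel (e : X.graph.Dart) : U :=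
  if e.fst ≠ X.root ∧ X.parent e.fst = e.snd then X.label e.fst else rev (X.label e.snd)

theorem dartLabel_up {e : X.graph.Dart} (h : e.fst ≠ X.root ∧ X.parent e.fst = e.snd) :
    X.dartLabel e = X.label e.fst := if_pos h

theorem dartLabel_down {e : X.graph.Dart} (h : e.snd ≠ X.root ∧ X.parent e.snd = e.fst) :
    X.dartLabel e = rev (X.label e.snd) := if_neg fun h' => X.not_both h' h

/-- The star at a vertex. -/
def starAt (v : X.V) : Set U :=
  {x | (v ≠ X.root ∧ x = rev (X.label v)) ∨ ∃ w, w ≠ X.root ∧ X.parent w = v ∧ X.label w = x}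

theorem starAt_eq (t : X.V) : {x | ∃ e : X.graph.Dart, e.snd = t ∧ X.dartLabel e = x} =
    X.starAt t := by
  ext x
  constructor
  · rintro ⟨⟨⟨v, w⟩, h | h⟩, rfl, rfl⟩
    · rw [X.dartLabel_up h]
      exact Or.inr ⟨v, h.1, h.2, rfl⟩
    · rw [X.dartLabel_down h]
      exact Or.inl ⟨h.1, rfl⟩
  · rintro (⟨h, rfl⟩ | ⟨w, h, rfl, rfl⟩)
    · exact ⟨⟨(X.parent t, t), Or.inr ⟨h, rfl⟩⟩, rfl, X.dartLabel_down ⟨h, rfl⟩⟩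
    · exact ⟨⟨(w, X.parent w), Or.inl ⟨h, rfl⟩⟩, rfl, X.dartLabel_up ⟨h, rfl⟩⟩

theorem starAt_root : X.starAt X.root = C := by
  refine Eq.trans ?_ X.root_star
  ext x
  simp [starAt]

theorem starAt_mem (hC : C ∈ F) (t : X.V) : X.starAt t ∈ F := by
  by_cases h : t = X.root
  · rw [h, starAt_root]
    exact hC
  · convert X.star_mem t h using 1
    ext x
    simp [starAt, h]

variable {S : Set U}

theorem label_mem (hF : ∀ τ ∈ F, τ ⊆ S) (hrev : ∀ x ∈ S, rev x ∈ S) {v : X.V} (h : v ≠ X.root) : X.label v ∈ S := by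
  have := hrev _ (hF _ (X.star_mem v h) (Set.mem_insert _ _))
  rwa [rev_rev] at this

/-- The tree over `F` given by a rooted tree. -/
noncomputable def toSTree (hF : ∀ τ ∈ F, τ ⊆ S) (hrev : ∀ x ∈ S, rev x ∈ S)
    (hC : C ∈ F) (hne : C.Nonempty) : STree S F where
  V := X.V
  finite_V := X.finite_V
  T := X.graph
  isTree := X.isTree_graph
  exists_edge := by
    obtain ⟨x, hx⟩ := hne
    rw [← X.root_star] at hx
    obtain ⟨w, hw, hp, -⟩ := hx
    exact ⟨w, X.root, Or.inl ⟨hw, hp⟩⟩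
  α := X.dartLabel
  α_mem := by
    rintro ⟨⟨v, w⟩, h | h⟩
    · rw [X.dartLabel_up h]
      exact X.label_mem hF hrev h.1
    · rw [X.dartLabel_down h]
      exact hrev _ (X.label_mem hF hrev h.1)
  α_symm := by
    rintro ⟨⟨v, w⟩, h | h⟩
    · refine Eq.trans (X.dartLabel_down h) ?_
      rw [X.dartLabel_up h]
      rfl
    · refine Eq.trans (X.dartLabel_up h) ?_
      rw [X.dartLabel_down h, rev_rev]
      rfl
  star_mem := fun t => by
    rw [X.starAt_eq]
    exact X.starAt_mem hC t

/-- A vertex whose star is a singleton is a leaf. -/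
theorem isLeafSeparation_of_starAt_eq (hF : ∀ τ ∈ F, τ ⊆ S) (hrev : ∀ x ∈ S, rev x ∈ S)
    (hC : C ∈ F) (hne : C.Nonempty) {v : X.V} {s : U}
    (hv : X.starAt v = {rev s}) : (X.toSTree hF hrev hC hne).IsLeafSeparation s := by
  -- All edges at `v` carry the label `s*` towards `v`. As labels at a vertex are distinct, there is
  -- only one such edge.
  have hchild : ∀ w, w ≠ X.root → X.parent w = v → X.label w = rev s := fun w hw hp => by
    have : X.label w ∈ X.starAt v := Or.inr ⟨w, hw, hp, rfl⟩
    rwa [hv] at this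
  by_cases h : v = X.root
  · have hs : rev s ∈ X.starAt v := hv ▸ rfl
    obtain ⟨h', -⟩ | ⟨w, hw, hp, hl⟩ := hs
    · exact (h' h).elim
    refine ⟨⟨(v, w), Or.inr ⟨hw, hp⟩⟩, ?_, ?_⟩
    · rintro u (⟨h', -⟩ | ⟨hu, hpu⟩)
      · exact (h' h).elim
      · exact X.child_inj u w hu hw (hpu.trans hp.symm) ((hchild u hu hpu).trans hl.symm)
    · exact (X.dartLabel_down ⟨hw, hp⟩).trans (by rw [hl, rev_rev])
  · have hs : rev (X.label v) = rev s := by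
      have : rev (X.label v) ∈ X.starAt v := Or.inl ⟨h, rfl⟩
      rwa [hv] at this
    refine ⟨⟨(v, X.parent v), Or.inl ⟨h, rfl⟩⟩, ?_, ?_⟩
    · rintro u (⟨-, rfl⟩ | ⟨hu, rfl⟩)
      · rfl
      · exact (X.label_ne u hu h ((hchild u hu rfl).trans hs.symm)).elim
    · exact (X.dartLabel_up ⟨h, rfl⟩).trans (rev_injective hs)

/-- Every orientation contains the star at some vertex. -/
theorem exists_starAt_subset (hF : ∀ τ ∈ F, τ ⊆ S) (hrev : ∀ x ∈ S, rev x ∈ S)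
    {Q : Set U} (hQ : ∀ x ∈ S, x ∈ Q ∨ rev x ∈ Q) :
    ∃ v, X.starAt v ⊆ Q := by
  have := X.finite_V
  -- Take a deepest vertex whose parent edge `Q` orients towards it (vacuous at the root): by
  -- maximality `Q` orients all child edges towards it too.
  obtain ⟨v, hv, hmax⟩ := Set.exists_max_image {v | v ≠ X.root → rev (X.label v) ∈ Q} X.depth
    (Set.toFinite _) ⟨X.root, fun h => (h rfl).elim⟩
  refine ⟨v, ?_⟩
  rintro x (⟨h, rfl⟩ | ⟨w, hw, rfl, rfl⟩)
  · exact hv h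
  · refine (hQ _ (X.label_mem hF hrev hw)).resolve_right fun h => ?_
    have h1 := hmax w fun _ => h
    have h2 := X.depth_parent w hw
    omega

end RootedTree

end Trees

end SepUniverse

open SepUniverse in
theorem mainTheorem3 {U : Type*} [SepUniverse U] (ord : U → ℝ) (hord : IsOrderFunction ord)
    (k : ℝ) (hfin : (sepsBelow ord k).Finite)
    (φ : Set (Set U)) (hφ : ∀ P ∈ φ, IsProfile (sepsBelow ord k) P)
    (F : Set (Set U)) (hF : IsSetOfStars (sepsBelow ord k) F)
    (hstd : IsStandard (sepsBelow ord k) F)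
    (hcosmall : ∀ r ∈ sepsBelow ord k, CoSmall r → ¬ Degenerate r → {r} ∈ F)
    (hshift : ClosedUnderShifting (sepsBelow ord k) F)
    (hφF : φ = {O | IsTangle (sepsBelow ord k) F O})
    (σ : Set U) (hσ_sub : σ ⊆ sepsBelow ord k) (hσ_ne : σ.Nonempty) (hσ : IsStar σ)
    (hσ_ess : ∀ s ∈ σ, Essential ord (sepsBelow ord k) φ s) :
    (∃ O, IsTangle (sepsBelow ord k) (F ∪ {τ | ∃ s ∈ σ, τ = {rev s}}) O) ∨
      ∃ X : STree (sepsBelow ord k) (F ∪ {τ | ∃ s ∈ σ, τ = {rev s}}),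
        ∀ s ∈ σ, X.IsLeafSeparation s := by
  have hrev := hord.rev_mem_sepsBelow (k := k)
  have hess : ∀ s ∈ σ, ∃ P Q, IsTangle (sepsBelow ord k) F P ∧ IsTangle (sepsBelow ord k) F Q ∧
      DistinguishesEfficiently ord (sepsBelow ord k) s P Q ∧ s ∈ P ∧ rev s ∈ Q := by
    intro s hs
    obtain ⟨P, hP, Q, hQ, -, hsS, hd, hmin⟩ := hσ_ess s hs
    rw [hφF] at hP hQ
    rcases hd with ⟨h1, h2⟩ | ⟨h1, h2⟩
    · exact ⟨P, Q, hP, hQ, ⟨hsS, Or.inl ⟨h1, h2⟩, hmin⟩, h1, h2⟩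
    · refine ⟨Q, P, hQ, hP, ⟨hsS, Or.inl ⟨h2, h1⟩, fun t ht h => hmin t ht ?_⟩, h2, h1⟩
      exact h.elim (fun h => Or.inr h.symm) fun h => Or.inl h.symm
  -- An empty star would rule out all tangles, but `σ` is non-empty and its members distinguish
  -- some.
  have hF0 : ∅ ∉ F := fun h => by
    obtain ⟨s, hs⟩ := hσ_ne
    obtain ⟨P, _, hP, -⟩ := hess s hs
    exact hP.2.2 ∅ h (Set.empty_subset P)
  refine (tangle_or_hasTree_star hord hfin hF hF0 hcosmall hshift hσ_sub hσ hess).imp id fun h => ?_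
  have hFS : ∀ τ ∈ withLeaves F σ, τ ⊆ sepsBelow ord k := by
    rintro τ (hτ | ⟨z, hz, rfl⟩)
    · exact (hF τ hτ).1
    · exact Set.singleton_subset_iff.2 (hrev z (hσ_sub hz))
  obtain ⟨C, hC, hne, ⟨X⟩⟩ := h.exists_rootedTree fun τ hτ => hfin.subset (hFS τ hτ)
  refine ⟨X.toSTree hFS hrev hC hne, fun s hs => ?_⟩
  obtain ⟨_, Q, -, hQ, -, -, hsQ⟩ := hess s hs
  obtain ⟨v, hv⟩ := X.exists_starAt_subset hFS hrev fun x hx => (hQ.1.2 x hx).1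
  rcases X.starAt_mem hC v with hvF | ⟨t, ht, hvt⟩
  · exact (hQ.2.2 _ hvF hv).elim
  · have htQ : rev t ∈ Q := hv (hvt ▸ rfl)
    -- `Q` contains both `s*` and `t*`, so the comparison applies in both directions and gives `t =
    -- s`.
    have h1 := le_of_rev_mem_tangle hQ hσ (hσ_sub hs) hs ht hsQ htQ le_rfl
    have h2 := le_of_rev_mem_tangle hQ hσ (hσ_sub ht) ht hs htQ hsQ le_rfl
    obtain rfl := le_antisymm h1 h2
    exact X.isLeafSeparation_of_starAt_eq hFS hrev hC hne hvt
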